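/- Let $n,m,p,q,T\ge 0$ be integers. Consider the discrete-time LTI plant $x[t+1]=Ax[t]+Bu[t]+\delta_x[t]$, $y[t]=Cx[t]+\delta_y[t]$ with $x[t]\in\mathbb{R}^n$, $u[t]\in\mathbb{R}^m$, $y[t]\in\mathbb{R}^p$, in feedback with the dynamic controller $\xi[t+1]=A_k\xi[t]+B_ky[t]$, $u[t]=C_k\xi[t]+D_ky[t]+\delta_u[t]$ with $\xi[t]\in\mathbb{R}^q$, all matrices being real. Let $\mathbf{K}=C_k(zI-A_k)^{-1}B_k+D_k$. The closed-loop transfer matrix $\mathbf{\Phi}$ from the disturbances $(\delta_x,\delta_y,\delta_u)$ to the signals $(x,y,u)$ has the blocks $$\begin{aligned} \mathbf{\Phi}_{xx}&=(zI-A-B\mathbf{K}C)^{-1}, & \mathbf{\Phi}_{xy}&=\mathbf{\Phi}_{xx}B\mathbf{K}, & \mathbf{\Phi}_{xu}&=\mathbf{\Phi}_{xx}B,\\ \mathbf{\Phi}_{yx}&=C\mathbf{\Phi}_{xx}, & \mathbf{\Phi}_{yy}&=C\mathbf{\Phi}_{xx}B\mathbf{K}+I, & \mathbf{\Phi}_{yu}&=C\mathbf{\Phi}_{xx}B,\\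 \mathbf{\Phi}_{ux}&=\mathbf{K}C\mathbf{\Phi}_{xx}, & \mathbf{\Phi}_{uy}&=\mathbf{K}(C\mathbf{\Phi}_{xx}B\mathbf{K}+I), & \mathbf{\Phi}_{uu}&=\mathbf{K}C\mathbf{\Phi}_{xx}B+I, \end{aligned}$$ where $\mathbf{\Phi}_{ab}$ is the response from $\delta_b$ to $a$. Let $\mathcal{F}_T$ be the set of transfer matrices (of any size) with finite impulse response of horizon $T$, i.e. the real-rational proper transfer matrices with all poles in the open unit disc that can be written as $\sum_{k=0}^{T}z^{-k}H_k$ with real matrices $H_k$. Consider the statements (i) $\mathbf{\Phi}\in\mathcal{F}_T$; (ii) (SLP) $\begin{bmatrix}\mathbf{\Phi}_{xx}&\mathbf{\Phi}_{xy}\\ \mathbf{\Phi}_{ux}&\mathbf{\Phi}_{uy}\end{bmatrix}\in\mathcal{F}_T$; (iii) (Mixed I) $\begin{bmatrix}\mathbf{\Phi}_{yx}&\mathbf{\Phi}_{yy}\\ \mathbf{\Phi}_{ux}&\mathbf{\Phi}_{uy}\end{bmatrix}\in\mathcal{F}_T$; (iv) (Mixed II) $\begin{bmatrix}\mathbf{\Phi}_{xy}&\mathbf{\Phi}_{xu}\\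 \mathbf{\Phi}_{uy}&\mathbf{\Phi}_{uu}\end{bmatrix}\in\mathcal{F}_T$; (v) (IOP) $\begin{bmatrix}\mathbf{\Phi}_{yy}&\mathbf{\Phi}_{yu}\\ \mathbf{\Phi}_{uy}&\mathbf{\Phi}_{uu}\end{bmatrix}\in\mathcal{F}_T$. If $(A,B,C)$ and $(A_k,B_k,C_k)$ are both stabilizable and detectable, then (i) $\Leftrightarrow$ (ii) $\Rightarrow$ (iii) $\Rightarrow$ (v) and (i) $\Leftrightarrow$ (ii) $\Rightarrow$ (iv) $\Rightarrow$ (v). If $(A,B,C)$ and $(A_k,B_k,C_k)$ are both controllable and observable, then (i), (ii), (iii), (iv) and (v) are all equivalent. -/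

import Mathlib

open Matrix

noncomputable section

namespace ClosedLoop

/-! ### State-space data -/

/-- A strictly proper discrete-time LTI plant
`x[t+1] = A x[t] + B u[t] + δx[t]`, `y[t] = C x[t] + δy[t]`,
with `n` states, `m` inputs and `p` outputs. -/
structure Plant (n m p : ℕ) where
  A : Matrix (Fin n) (Fin n) ℝ
  B : Matrix (Fin n) (Fin m) ℝ
  C : Matrix (Fin p) (Fin n) ℝ

/-- A discrete-time LTI dynamic controller
`ξ[t+1] = Ak ξ[t] + Bk y[t]`, `u[t] = Ck ξ[t] + Dk y[t] + δu[t]`,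
with `q` internal states. -/
structure Controller (q m p : ℕ) where
  Ak : Matrix (Fin q) (Fin q) ℝ
  Bk : Matrix (Fin q) (Fin p) ℝ
  Ck : Matrix (Fin m) (Fin q) ℝ
  Dk : Matrix (Fin m) (Fin p) ℝ

/-- Discrete-time asymptotic stability of a real square matrix: all its complex eigenvalues lie
in the open unit disc. -/
def IsStableMatrix {n : ℕ} (A : Matrix (Fin n) (Fin n) ℝ) : Prop :=
  ∀ s ∈ spectrum ℂ (A.map (algebraMap ℝ ℂ)), ‖s‖ < 1

/-- `(A, B)` is stabilizable: some state feedback makes `A + B F` stable. -/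
def Stabilizable {n m : ℕ} (A : Matrix (Fin n) (Fin n) ℝ) (B : Matrix (Fin n) (Fin m) ℝ) : Prop :=
  ∃ F : Matrix (Fin m) (Fin n) ℝ, IsStableMatrix (A + B * F)

/-- `(A, C)` is detectable: some output injection makes `A + L C` stable. -/
def Detectable {n p : ℕ} (A : Matrix (Fin n) (Fin n) ℝ) (C : Matrix (Fin p) (Fin n) ℝ) : Prop :=
  ∃ L : Matrix (Fin n) (Fin p) ℝ, IsStableMatrix (A + L * C)

/-- The controllability matrix `[B, A B, …, A ^ (n - 1) B]`; its columns are indexed by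
`(k, j)`, the `j`-th column of `A ^ k B`. -/
def controllabilityMatrix {n m : ℕ} (A : Matrix (Fin n) (Fin n) ℝ)
    (B : Matrix (Fin n) (Fin m) ℝ) : Matrix (Fin n) (Fin n × Fin m) ℝ :=
  Matrix.of fun i kj => (A ^ (kj.1 : ℕ) * B) i kj.2

/-- The observability matrix `[C; C A; …; C A ^ (n - 1)]`; its rows are indexed by
`(k, i)`, the `i`-th row of `C A ^ k`. -/
def observabilityMatrix {n p : ℕ} (A : Matrix (Fin n) (Fin n) ℝ)
    (C : Matrix (Fin p) (Fin n) ℝ) : Matrix (Fin n × Fin p) (Fin n) ℝ :=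
  Matrix.of fun ki j => (C * A ^ (ki.1 : ℕ)) ki.2 j

/-- `(A, B)` is controllable: the controllability matrix has full row rank. -/
def Controllable {n m : ℕ} (A : Matrix (Fin n) (Fin n) ℝ) (B : Matrix (Fin n) (Fin m) ℝ) : Prop :=
  (controllabilityMatrix A B).rank = n

/-- `(A, C)` is observable: the observability matrix has full column rank. -/
def Observable {n p : ℕ} (A : Matrix (Fin n) (Fin n) ℝ) (C : Matrix (Fin p) (Fin n) ℝ) : Prop :=
  (observabilityMatrix A C).rank = n

/-! ### Transfer matrices -/

/-- Real-rational transfer matrices: matrices over the field `ℝ(z)`. -/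
abbrev TransferMatrix (ι κ : Type) : Type := Matrix ι κ (RatFunc ℝ)

/-- A real matrix, seen as a constant transfer matrix. -/
def const {ι κ : Type} (M : Matrix ι κ ℝ) : TransferMatrix ι κ :=
  M.map (RatFunc.C : ℝ →+* RatFunc ℝ)

/-- The transfer matrix `z I`. -/
def zI (n : ℕ) : TransferMatrix (Fin n) (Fin n) :=
  (RatFunc.X : RatFunc ℝ) • (1 : TransferMatrix (Fin n) (Fin n))

/-- `RH∞`: real-rational transfer matrices that are proper and stable, i.e. every entry is proper
and all its poles lie in the open unit disc (discrete time). -/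
def RHinf (ι κ : Type) : Set (TransferMatrix ι κ) :=
  {H | ∀ i j, (H i j).num.natDegree ≤ (H i j).denom.natDegree ∧
    ∀ s : ℂ, Polynomial.aeval s (H i j).denom = 0 → ‖s‖ < 1}

/-- `F_T`: stable transfer matrices with finite impulse response of horizon `T`,
`H = ∑_{k=0}^{T} z^{-k} H_k` with real matrices `H_k`. -/
def FIR (T : ℕ) (ι κ : Type) : Set (TransferMatrix ι κ) :=
  {H | H ∈ RHinf ι κ ∧ ∃ Hk : ℕ → Matrix ι κ ℝ,
    H = ∑ k ∈ Finset.range (T + 1), ((RatFunc.X : RatFunc ℝ) ^ k)⁻¹ • const (Hk k)}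

/-- The transfer matrix `K = Ck (zI - Ak)⁻¹ Bk + Dk` of a controller, from `y` to `u`. -/
def Controller.transfer {q m p : ℕ} (K : Controller q m p) : TransferMatrix (Fin m) (Fin p) :=
  const K.Ck * (zI q - const K.Ak)⁻¹ * const K.Bk + const K.Dk

/-! ### Closed-loop responses from `(δx, δy, δu)` to `(x, y, u)` -/

section Responses

variable {n m p q : ℕ} (G : Plant n m p) (K : Controller q m p)

def Phi_xx : TransferMatrix (Fin n) (Fin n) :=
  (zI n - const G.A - const G.B * K.transfer * const G.C)⁻¹

def Phi_xy : TransferMatrix (Fin n) (Fin p) := Phi_xx G K * const G.B * K.transfer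

def Phi_xu : TransferMatrix (Fin n) (Fin m) := Phi_xx G K * const G.B

def Phi_yx : TransferMatrix (Fin p) (Fin n) := const G.C * Phi_xx G K

def Phi_yy : TransferMatrix (Fin p) (Fin p) :=
  const G.C * Phi_xx G K * const G.B * K.transfer + 1

def Phi_yu : TransferMatrix (Fin p) (Fin m) := const G.C * Phi_xx G K * const G.B

def Phi_ux : TransferMatrix (Fin m) (Fin n) := K.transfer * const G.C * Phi_xx G K

def Phi_uy : TransferMatrix (Fin m) (Fin p) :=
  K.transfer * (const G.C * Phi_xx G K * const G.B * K.transfer + 1)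

def Phi_uu : TransferMatrix (Fin m) (Fin m) :=
  K.transfer * const G.C * Phi_xx G K * const G.B + 1

/-- The full closed-loop response from `(δx, (δy, δu))` to `(x, (y, u))`. -/
def Phi : TransferMatrix (Fin n ⊕ (Fin p ⊕ Fin m)) (Fin n ⊕ (Fin p ⊕ Fin m)) :=
  fromBlocks (Phi_xx G K) (fromCols (Phi_xy G K) (Phi_xu G K))
    (fromRows (Phi_yx G K) (Phi_ux G K))
    (fromBlocks (Phi_yy G K) (Phi_yu G K) (Phi_uy G K) (Phi_uu G K))

/-- `(δx, δy) → (x, u)` (system-level parameterization). -/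
def Phi_SLP : TransferMatrix (Fin n ⊕ Fin m) (Fin n ⊕ Fin p) :=
  fromBlocks (Phi_xx G K) (Phi_xy G K) (Phi_ux G K) (Phi_uy G K)

/-- `(δx, δy) → (y, u)` (mixed parameterization I). -/
def Phi_MixedI : TransferMatrix (Fin p ⊕ Fin m) (Fin n ⊕ Fin p) :=
  fromBlocks (Phi_yx G K) (Phi_yy G K) (Phi_ux G K) (Phi_uy G K)

/-- `(δy, δu) → (x, u)` (mixed parameterization II). -/
def Phi_MixedII : TransferMatrix (Fin n ⊕ Fin m) (Fin p ⊕ Fin m) :=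
  fromBlocks (Phi_xy G K) (Phi_xu G K) (Phi_uy G K) (Phi_uu G K)

/-- `(δy, δu) → (y, u)` (input-output parameterization). -/
def Phi_IOP : TransferMatrix (Fin p ⊕ Fin m) (Fin p ⊕ Fin m) :=
  fromBlocks (Phi_yy G K) (Phi_yu G K) (Phi_uy G K) (Phi_uu G K)

end Responses

/-! ### Well-posedness: the inverses above are genuine inverses -/

theorem det_zI_sub_const_ne_zero {q : ℕ} (M : Matrix (Fin q) (Fin q) ℝ) :
    (zI q - const M).det ≠ 0 := by
  have h : zI q - const M = (algebraMap (Polynomial ℝ) (RatFunc ℝ)).mapMatrix M.charmatrix := by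
    ext i j
    by_cases hij : i = j
    · subst hij
      simp [zI, const, charmatrix, RatFunc.algebraMap_X]
    · simp [zI, const, charmatrix, hij]
  rw [h, ← RingHom.map_det]
  simpa [Matrix.charpoly] using (Matrix.charpoly_monic M).ne_zero

/-- The feedback loop of a strictly proper plant and a proper controller is well posed:
`zI - A - B K C` is invertible over `ℝ(z)`. -/
theorem wellPosed {n m p q : ℕ} (G : Plant n m p) (K : Controller q m p) :
    IsUnit (zI n - const G.A - const G.B * K.transfer * const G.C).det := by
  have hk : (zI q - const K.Ak).det ≠ 0 := det_zI_sub_const_ne_zero K.Ak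
  have hne : (fromBlocks (zI n - const (G.A + G.B * K.Dk * G.C)) (-const (G.B * K.Ck))
      (-const (K.Bk * G.C)) (zI q - const K.Ak)).det ≠ 0 := by
    set M : Matrix (Fin n ⊕ Fin q) (Fin n ⊕ Fin q) ℝ :=
      fromBlocks (G.A + G.B * K.Dk * G.C) (G.B * K.Ck) (K.Bk * G.C) K.Ak with hM
    have h : fromBlocks (zI n - const (G.A + G.B * K.Dk * G.C)) (-const (G.B * K.Ck))
        (-const (K.Bk * G.C)) (zI q - const K.Ak) =
        (algebraMap (Polynomial ℝ) (RatFunc ℝ)).mapMatrix M.charmatrix := by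
      rw [hM, charmatrix_fromBlocks]
      ext (i | i) (j | j)
      · by_cases hij : i = j
        · subst hij
          simp [zI, const, charmatrix, RatFunc.algebraMap_X]
        · simp [zI, const, charmatrix, hij]
      · simp [const, -Matrix.map_mul]
      · simp [const, -Matrix.map_mul]
      · by_cases hij : i = j
        · subst hij
          simp [zI, const, charmatrix, RatFunc.algebraMap_X]
        · simp [zI, const, charmatrix, hij]
    rw [h, ← RingHom.map_det]
    simpa [Matrix.charpoly] using (Matrix.charpoly_monic M).ne_zero
  have : Invertible (zI q - const K.Ak) :=
    Matrix.invertibleOfIsUnitDet _ (isUnit_iff_ne_zero.mpr hk)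
  rw [det_fromBlocks₂₂, invOf_eq_nonsing_inv] at hne
  have := right_ne_zero_of_mul hne
  rw [isUnit_iff_ne_zero]
  convert this using 2
  simp only [Controller.transfer, const, Matrix.map_mul, Matrix.mul_add, Matrix.add_mul,
    Matrix.neg_mul, Matrix.mul_neg, neg_neg, Matrix.mul_assoc,
    Matrix.map_add _ (map_add (RatFunc.C : ℝ →+* RatFunc ℝ))]
  abel

end ClosedLoop

end

/-!
The implications from more responses to fewer, and the step from `Phi_SLP` to `Phi`, are algebra:
the remaining blocks arise from the given ones by multiplying with the constant matrices `B`, `C`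
and adding constants. These operations preserve `FIR`, because membership in `FIR` just says that
every entry lies in the real span of `1, z⁻¹, …, z⁻ᵀ` (`mem_FIR_iff`); properness and stability are
then automatic, all poles being at the origin. They need no assumption on the realizations.

The converse from `Phi_IOP` to `Phi_SLP` uses minimality. Let `N` be the state matrix of the closed
loop on plant and controller states. Its resolvent `R = (zI - N)⁻¹` has `Phi_xx` as a block, and the
blocks of `diag(C, Ck) R diag(B, Bk)` are constant combinations of those of `Phi_IOP`
(`clOutput_mul_clResolvent_mul_clInput`). If these have horizon `T`, the Markov parameters
`diag(C, Ck) N ^ k diag(B, Bk)` vanish for `k ≥ T` (`markov_eq_zero_of_mem_FIR`), because a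
polynomial that is strictly proper is zero. Since `N` differs from `diag(A, Ak)` by a state
feedback, and also by an output injection, it inherits controllability and observability, so
`N ^ T = 0` (`pow_eq_zero_of_markov_eq_zero`). Then `R = ∑_{k < T} z⁻⁽ᵏ⁺¹⁾ N ^ k` has horizon `T`, and
so do `Phi_xx`, `Phi_xy` and `Phi_ux`, which are constant combinations of its blocks.
-/

namespace ClosedLoop

-- The valuation at infinity asks for decidable equality on `ℝ(z)`.
open scoped Classical

/-! ### Finite impulse responses, entry by entry -/

/-- The real span of `1, z⁻¹, …, z⁻ᵀ` in `ℝ(z)`: the scalar transfer functions with finite impulse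
response of horizon `T`. -/
noncomputable def firSpan (T : ℕ) : Submodule ℝ (RatFunc ℝ) :=
  Submodule.span ℝ (Set.range fun k : Fin (T + 1) => ((RatFunc.X : RatFunc ℝ) ^ (k : ℕ))⁻¹)

theorem inv_X_pow_mem_firSpan {T k : ℕ} (hk : k ≤ T) :
    ((RatFunc.X : RatFunc ℝ) ^ k)⁻¹ ∈ firSpan T :=
  Submodule.subset_span ⟨⟨k, by omega⟩, rfl⟩

theorem C_mul_mem_firSpan {T : ℕ} {f : RatFunc ℝ} (a : ℝ) (hf : f ∈ firSpan T) :
    RatFunc.C a * f ∈ firSpan T := by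
  rw [← RatFunc.smul_eq_C_mul]
  exact Submodule.smul_mem _ a hf

theorem C_mem_firSpan (T : ℕ) (a : ℝ) : RatFunc.C a ∈ firSpan T := by
  simpa using C_mul_mem_firSpan a (inv_X_pow_mem_firSpan (Nat.zero_le T))

theorem X_pow_mul_firSpan {T : ℕ} {f : RatFunc ℝ} (hf : f ∈ firSpan T) :
    ∃ g : Polynomial ℝ, RatFunc.X ^ T * f = algebraMap (Polynomial ℝ) (RatFunc ℝ) g := by
  induction hf using Submodule.span_induction with
  | mem x hx =>
    obtain ⟨k, rfl⟩ := hx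
    refine ⟨Polynomial.X ^ (T - k), ?_⟩
    have hk : (k : ℕ) ≤ T := by omega
    rw [map_pow, RatFunc.algebraMap_X, pow_sub₀ _ RatFunc.X_ne_zero hk]
  | zero => exact ⟨0, by simp⟩
  | add x y _ _ hx hy =>
    obtain ⟨a, ha⟩ := hx
    obtain ⟨b, hb⟩ := hy
    exact ⟨a + b, by rw [mul_add, ha, hb, map_add]⟩
  | smul c x _ hx =>
    obtain ⟨a, ha⟩ := hx
    exact ⟨Polynomial.C c * a, by
      rw [RatFunc.smul_eq_C_mul, mul_left_comm, ha, map_mul, RatFunc.algebraMap_C]⟩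

theorem inftyValuation_C_le_one (a : ℝ) : RatFunc.inftyValuation ℝ (RatFunc.C a) ≤ 1 := by
  by_cases ha : a = 0
  · simp [ha]
  · exact (RatFunc.inftyValuation.C ℝ ha).le

theorem one_lt_inftyValuation_X : 1 < RatFunc.inftyValuation ℝ RatFunc.X := by
  rw [RatFunc.inftyValuation.X, ← WithZero.exp_zero, WithZero.exp_lt_exp]
  exact one_pos

theorem inftyValuation_le_one_of_mem_firSpan {T : ℕ} {f : RatFunc ℝ} (hf : f ∈ firSpan T) :
    RatFunc.inftyValuation ℝ f ≤ 1 := by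
  induction hf using Submodule.span_induction with
  | mem x hx =>
    obtain ⟨k, rfl⟩ := hx
    rw [map_inv₀, map_pow]
    exact inv_le_one_of_one_le₀ (one_le_pow₀ one_lt_inftyValuation_X.le)
  | zero => simp
  | add x y _ _ hx hy => exact (Valuation.map_add _ x y).trans (max_le hx hy)
  | smul c x _ hx =>
    rw [RatFunc.smul_eq_C_mul, map_mul]
    exact mul_le_one' (inftyValuation_C_le_one c) hx

theorem natDegree_num_le_of_inftyValuation_le_one {f : RatFunc ℝ}
    (hf : RatFunc.inftyValuation ℝ f ≤ 1) : f.num.natDegree ≤ f.denom.natDegree := by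
  by_cases h0 : f = 0
  · simp [h0]
  · rw [RatFunc.inftyValuation_apply, RatFunc.inftyValuation_of_nonzero ℝ h0, ← WithZero.exp_zero,
      WithZero.exp_le_exp, RatFunc.intDegree] at hf
    omega

/-- The only possible pole of an element of `firSpan T` is the origin. -/
theorem eq_zero_of_aeval_denom_eq_zero {T : ℕ} {f : RatFunc ℝ} (hf : f ∈ firSpan T) {s : ℂ}
    (hs : Polynomial.aeval s f.denom = 0) : s = 0 := by
  obtain ⟨g, hg⟩ := X_pow_mul_firSpan hf
  have hX : (Polynomial.X ^ T : Polynomial ℝ) ≠ 0 := pow_ne_zero _ Polynomial.X_ne_zero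
  have hdvd : f.denom ∣ Polynomial.X ^ T := by
    rw [RatFunc.denom_dvd hX]
    refine ⟨g, ?_⟩
    rw [← hg, map_pow, RatFunc.algebraMap_X,
      mul_div_cancel_left₀ _ (pow_ne_zero _ RatFunc.X_ne_zero)]
  have h := map_dvd (Polynomial.aeval s) hdvd
  rw [hs, zero_dvd_iff, map_pow, Polynomial.aeval_X] at h
  exact eq_zero_of_pow_eq_zero h

/-- Membership in `FIR` is entrywise. Properness and stability come for free, since the only
poles of `∑ z⁻ᵏ Hₖ` are at the origin. -/
theorem mem_FIR_iff {T : ℕ} {ι κ : Type} {H : TransferMatrix ι κ} :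
    H ∈ FIR T ι κ ↔ ∀ i j, H i j ∈ firSpan T := by
  constructor
  · rintro ⟨-, Hk, rfl⟩ i j
    rw [Matrix.sum_apply]
    refine Submodule.sum_mem _ fun k hk => ?_
    rw [Matrix.smul_apply, smul_eq_mul, mul_comm]
    exact C_mul_mem_firSpan _ (inv_X_pow_mem_firSpan (by simpa [Nat.lt_succ_iff] using hk))
  · intro h
    refine ⟨fun i j => ⟨natDegree_num_le_of_inftyValuation_le_one
      (inftyValuation_le_one_of_mem_firSpan (h i j)), fun s hs => ?_⟩, ?_⟩
    · simp [eq_zero_of_aeval_denom_eq_zero (h i j) hs]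
    · choose c hc using fun i j => (Submodule.mem_span_range_iff_exists_fun ℝ).mp (h i j)
      refine ⟨fun k => Matrix.of fun i j => if hk : k < T + 1 then c i j ⟨k, hk⟩ else 0, ?_⟩
      ext i j
      rw [← hc, Matrix.sum_apply, Finset.sum_range]
      refine Finset.sum_congr rfl fun k _ => ?_
      simp only [const, Matrix.smul_apply, Matrix.map_apply, of_apply, k.is_lt, dite_true,
        RatFunc.smul_eq_C_mul, smul_eq_mul, mul_comm]

section Closure

variable {T : ℕ} {ι κ μ ν : Type}

theorem const_mem_FIR (M : Matrix ι κ ℝ) : const M ∈ FIR T ι κ :=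
  mem_FIR_iff.mpr fun _ _ => C_mem_firSpan T _

theorem add_mem_FIR {H H' : TransferMatrix ι κ} (h : H ∈ FIR T ι κ) (h' : H' ∈ FIR T ι κ) :
    H + H' ∈ FIR T ι κ := by
  rw [mem_FIR_iff] at *
  exact fun i j => Submodule.add_mem _ (h i j) (h' i j)

theorem sub_mem_FIR {H H' : TransferMatrix ι κ} (h : H ∈ FIR T ι κ) (h' : H' ∈ FIR T ι κ) :
    H - H' ∈ FIR T ι κ := by
  rw [mem_FIR_iff] at *
  exact fun i j => Submodule.sub_mem _ (h i j) (h' i j)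

theorem const_mul_mem_FIR [Fintype κ] (M : Matrix ι κ ℝ) {H : TransferMatrix κ μ}
    (h : H ∈ FIR T κ μ) : const M * H ∈ FIR T ι μ := by
  rw [mem_FIR_iff] at *
  exact fun i j => Submodule.sum_mem _ fun k _ => C_mul_mem_firSpan _ (h k j)

theorem mul_const_mem_FIR [Fintype κ] {H : TransferMatrix ι κ} (h : H ∈ FIR T ι κ)
    (M : Matrix κ μ ℝ) : H * const M ∈ FIR T ι μ := by
  rw [mem_FIR_iff] at *
  refine fun i j => Submodule.sum_mem _ fun k _ => ?_
  rw [mul_comm]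
  exact C_mul_mem_firSpan _ (h i k)

theorem const_one [DecidableEq ι] : const (1 : Matrix ι ι ℝ) = 1 :=
  Matrix.map_one _ (map_zero _) (map_one _)

theorem one_mem_FIR [DecidableEq ι] : (1 : TransferMatrix ι ι) ∈ FIR T ι ι :=
  const_one (ι := ι) ▸ const_mem_FIR 1

theorem const_mul [Fintype κ] (M : Matrix ι κ ℝ) (N : Matrix κ μ ℝ) :
    const (M * N) = const M * const N :=
  Matrix.map_mul

theorem const_add (M N : Matrix ι κ ℝ) : const (M + N) = const M + const N :=
  Matrix.map_add _ (map_add _) M N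

theorem fromBlocks_mem_FIR_iff {H₁ : TransferMatrix ι κ} {H₂ : TransferMatrix ι μ}
    {H₃ : TransferMatrix ν κ} {H₄ : TransferMatrix ν μ} :
    fromBlocks H₁ H₂ H₃ H₄ ∈ FIR T _ _ ↔
      (H₁ ∈ FIR T _ _ ∧ H₂ ∈ FIR T _ _) ∧ H₃ ∈ FIR T _ _ ∧ H₄ ∈ FIR T _ _ := by
  simp only [mem_FIR_iff, Sum.forall, forall_and, fromBlocks_apply₁₁, fromBlocks_apply₁₂,
    fromBlocks_apply₂₁, fromBlocks_apply₂₂]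
  tauto

theorem fromCols_mem_FIR_iff {H₁ : TransferMatrix ι κ} {H₂ : TransferMatrix ι μ} :
    fromCols H₁ H₂ ∈ FIR T _ _ ↔ H₁ ∈ FIR T _ _ ∧ H₂ ∈ FIR T _ _ := by
  simp [mem_FIR_iff, Sum.forall, forall_and]

theorem fromRows_mem_FIR_iff {H₁ : TransferMatrix ι κ} {H₂ : TransferMatrix μ κ} :
    fromRows H₁ H₂ ∈ FIR T _ _ ↔ H₁ ∈ FIR T _ _ ∧ H₂ ∈ FIR T _ _ := by
  simp [mem_FIR_iff, Sum.forall]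

end Closure

/-! ### Controllability and observability -/

section Observability

variable {ι κ μ ν : Type} [Fintype ι] [Fintype κ] [DecidableEq ι] [DecidableEq κ]

/-- The unobservable subspace of `(A, C)` is zero. This is observability with the powers of `A` not
cut off, over an arbitrary index type; controllability of `(A, B)` is the same condition on
`(Aᵀ, Bᵀ)`. -/
def UnobservableTrivial (A : Matrix ι ι ℝ) (C : Matrix μ ι ℝ) : Prop :=
  ∀ v : ι → ℝ, (∀ k : ℕ, (C * A ^ k) *ᵥ v = 0) → v = 0

theorem Observable.unobservableTrivial {n p : ℕ} {A : Matrix (Fin n) (Fin n) ℝ}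
    {C : Matrix (Fin p) (Fin n) ℝ} (h : Observable A C) : UnobservableTrivial A C := by
  intro v hv
  have hli : LinearIndependent ℝ (observabilityMatrix A C).col := by
    rw [linearIndependent_iff_card_eq_finrank_span, Set.finrank, ← rank_eq_finrank_span_cols, h,
      Fintype.card_fin]
  refine mulVec_injective_iff.mpr hli ?_
  rw [mulVec_zero]
  ext ⟨k, i⟩
  exact congrFun (hv k) i

theorem Controllable.unobservableTrivial {n m : ℕ} {A : Matrix (Fin n) (Fin n) ℝ}
    {B : Matrix (Fin n) (Fin m) ℝ} (h : Controllable A B) : UnobservableTrivial Aᵀ Bᵀ := by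
  have hT : observabilityMatrix Aᵀ Bᵀ = (controllabilityMatrix A B)ᵀ := by
    ext ⟨k, i⟩ j
    simp only [observabilityMatrix, controllabilityMatrix, of_apply, transpose_apply]
    rw [← transpose_pow, ← transpose_mul, transpose_apply]
  refine Observable.unobservableTrivial ?_
  rw [Observable, hT, rank_transpose]
  exact h

/-- Observability is invariant under output injection. -/
theorem UnobservableTrivial.add_mul [Fintype μ] {A : Matrix ι ι ℝ} {C : Matrix μ ι ℝ}
    (h : UnobservableTrivial A C) (L : Matrix ι μ ℝ) : UnobservableTrivial (A + L * C) C := by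
  intro v hv
  have hpow : ∀ k : ℕ, (A + L * C) ^ k *ᵥ v = A ^ k *ᵥ v := by
    intro k
    induction k with
    | zero => simp
    | succ k ih =>
      have hk : C *ᵥ (A ^ k *ᵥ v) = 0 := by
        rw [← ih, mulVec_mulVec]
        exact hv k
      rw [pow_succ', ← mulVec_mulVec, ih, add_mulVec, ← mulVec_mulVec _ L, hk, mulVec_zero,
        add_zero, mulVec_mulVec, ← pow_succ']
  refine h v fun k => ?_
  rw [← mulVec_mulVec, ← hpow, mulVec_mulVec]
  exact hv k

theorem UnobservableTrivial.fromBlocks_diagonal {A : Matrix ι ι ℝ} {C : Matrix μ ι ℝ}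
    {A' : Matrix κ κ ℝ} {C' : Matrix ν κ ℝ} (h : UnobservableTrivial A C)
    (h' : UnobservableTrivial A' C') :
    UnobservableTrivial (fromBlocks A 0 0 A') (fromBlocks C 0 0 C') := by
  intro v hv
  have hk : ∀ k : ℕ, (C * A ^ k) *ᵥ (v ∘ Sum.inl) = 0 ∧ (C' * A' ^ k) *ᵥ (v ∘ Sum.inr) = 0 := by
    intro k
    have := hv k
    rw [fromBlocks_diagonal_pow, fromBlocks_multiply, fromBlocks_mulVec] at this
    simp only [Matrix.mul_zero, Matrix.zero_mul, add_zero, zero_add, zero_mulVec] at this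
    exact ⟨funext fun i => congrFun this (Sum.inl i), funext fun i => congrFun this (Sum.inr i)⟩
  have h₁ := h _ fun k => (hk k).1
  have h₂ := h' _ fun k => (hk k).2
  ext (i | i)
  · exact congrFun h₁ i
  · exact congrFun h₂ i

theorem UnobservableTrivial.matrix_eq_zero {A : Matrix ι ι ℝ} {C : Matrix μ ι ℝ}
    (h : UnobservableTrivial A C) {Z : Matrix ι ν ℝ} (hZ : ∀ k : ℕ, C * A ^ k * Z = 0) :
    Z = 0 := by
  ext i j
  refine congrFun (h (fun i => Z i j) fun k => ?_) i
  ext l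
  exact congrFun (congrFun (hZ k) l) j

/-- A minimal realization whose Markov parameters vanish from order `T` on has `A ^ T = 0`:
the product of the observability matrix, `A ^ T` and the controllability matrix is zero. -/
theorem pow_eq_zero_of_markov_eq_zero {A : Matrix ι ι ℝ} {B : Matrix ι ν ℝ} {C : Matrix μ ι ℝ}
    (hB : UnobservableTrivial Aᵀ Bᵀ) (hC : UnobservableTrivial A C) {T : ℕ}
    (h : ∀ k : ℕ, C * A ^ (T + k) * B = 0) : A ^ T = 0 := by
  refine hC.matrix_eq_zero fun j => ?_
  rw [← transpose_eq_zero]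
  refine hB.matrix_eq_zero fun k => ?_
  rw [← transpose_pow, ← transpose_mul, ← transpose_mul, transpose_eq_zero, ← Matrix.mul_assoc,
    Matrix.mul_assoc C, Matrix.mul_assoc C, ← pow_add, ← pow_add,
    show j + T + k = T + (j + k) by ring]
  exact h _

end Observability

/-! ### Resolvents and Markov parameters -/

section Resolvent

variable {ι κ μ : Type} [Fintype ι]

theorem eq_zero_of_C_of_inftyValuation_lt_one {a : ℝ}
    (h : RatFunc.inftyValuation ℝ (RatFunc.C a) < 1) : a = 0 := by
  by_contra ha
  exact h.ne (RatFunc.inftyValuation.C ℝ ha)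

theorem eq_zero_of_polynomial_of_inftyValuation_lt_one {g : Polynomial ℝ}
    (h : RatFunc.inftyValuation ℝ (algebraMap (Polynomial ℝ) (RatFunc ℝ) g) < 1) : g = 0 := by
  by_contra hg
  rw [RatFunc.inftyValuation_apply, RatFunc.inftyValuation.polynomial ℝ hg, ← WithZero.exp_zero,
    WithZero.exp_lt_exp] at h
  omega

theorem inftyValuation_const_mul_lt_one {L : TransferMatrix ι κ}
    (hL : ∀ i j, RatFunc.inftyValuation ℝ (L i j) < 1) (W : Matrix μ ι ℝ) (i : μ) (j : κ) :
    RatFunc.inftyValuation ℝ ((const W * L) i j) < 1 := by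
  rw [Matrix.mul_apply]
  refine Valuation.map_sum_lt _ one_ne_zero fun k _ => ?_
  rw [map_mul]
  exact (mul_le_of_le_one_left' (inftyValuation_C_le_one _)).trans_lt (hL k j)

theorem inftyValuation_mul_const_lt_one {L : TransferMatrix κ ι}
    (hL : ∀ i j, RatFunc.inftyValuation ℝ (L i j) < 1) (V : Matrix ι μ ℝ) (i : κ) (j : μ) :
    RatFunc.inftyValuation ℝ ((L * const V) i j) < 1 := by
  rw [Matrix.mul_apply]
  refine Valuation.map_sum_lt _ one_ne_zero fun k _ => ?_
  rw [map_mul]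
  exact (mul_le_of_le_one_right' (inftyValuation_C_le_one _)).trans_lt (hL i k)

variable [DecidableEq ι] {N : Matrix ι ι ℝ} {R : TransferMatrix ι ι}

/-- The resolvent is strictly proper. If the largest valuation of an entry were at least `1`, then
`z R = 1 + N R` would bound `|z|` times it by itself, although `|z| > 1`. -/
theorem inftyValuation_resolvent_lt_one
    (hR : (RatFunc.X : RatFunc ℝ) • R = 1 + const N * R) (i j : ι) :
    RatFunc.inftyValuation ℝ (R i j) < 1 := by
  set v := RatFunc.inftyValuation ℝ
  obtain ⟨⟨a, b⟩, -, hmax⟩ := Finset.exists_max_image Finset.univ (fun x : ι × ι => v (R x.1 x.2))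
    ⟨(i, j), Finset.mem_univ _⟩
  refine (hmax (i, j) (Finset.mem_univ _)).trans_lt ?_
  by_contra! hge
  have hab : RatFunc.X * R a b = (1 : TransferMatrix ι ι) a b + (const N * R) a b :=
    congrFun (congrFun hR a) b
  have hle : v (RatFunc.X * R a b) ≤ v (R a b) := by
    rw [hab]
    refine (Valuation.map_add _ _ _).trans (max_le ?_ ?_)
    · refine le_trans ?_ hge
      by_cases h : a = b <;> simp [Matrix.one_apply, h]
    · rw [Matrix.mul_apply]
      refine Valuation.map_sum_le _ fun k _ => ?_
      rw [map_mul]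
      exact (mul_le_of_le_one_left' (inftyValuation_C_le_one _)).trans
        (hmax (k, b) (Finset.mem_univ _))
  rw [map_mul] at hle
  exact hle.not_gt (lt_mul_of_one_lt_left (one_pos.trans_le hge) one_lt_inftyValuation_X)

/-- The Neumann expansion of the resolvent at infinity, with remainder. -/
theorem resolvent_eq_sum_add (hR : (RatFunc.X : RatFunc ℝ) • R = 1 + const N * R) (j : ℕ) :
    R = ∑ k ∈ Finset.range j, ((RatFunc.X : RatFunc ℝ) ^ (k + 1))⁻¹ • const (N ^ k) +
      ((RatFunc.X : RatFunc ℝ) ^ j)⁻¹ • (const (N ^ j) * R) := by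
  induction j with
  | zero => simp [const_one]
  | succ j ih =>
    have hstep : R = (RatFunc.X : RatFunc ℝ)⁻¹ • (1 + const N * R) := by
      rw [← hR, smul_smul, inv_mul_cancel₀ RatFunc.X_ne_zero, one_smul]
    have hrem : ((RatFunc.X : RatFunc ℝ) ^ j)⁻¹ • (const (N ^ j) * R) =
        ((RatFunc.X : RatFunc ℝ) ^ (j + 1))⁻¹ • const (N ^ j) +
          ((RatFunc.X : RatFunc ℝ) ^ (j + 1))⁻¹ • (const (N ^ (j + 1)) * R) := by
      conv_lhs => rw [hstep]
      rw [Matrix.mul_smul, smul_smul, ← mul_inv, ← pow_succ, Matrix.mul_add, Matrix.mul_one,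
        smul_add, ← Matrix.mul_assoc, ← const_mul, ← pow_succ]
    rw [Finset.sum_range_succ, add_assoc, ← hrem]
    exact ih

theorem sum_mem_FIR (N : Matrix ι ι ℝ) (T : ℕ) :
    ∑ k ∈ Finset.range T, ((RatFunc.X : RatFunc ℝ) ^ (k + 1))⁻¹ • const (N ^ k) ∈ FIR T ι ι := by
  rw [mem_FIR_iff]
  intro i j
  rw [Matrix.sum_apply]
  refine Submodule.sum_mem _ fun k hk => ?_
  rw [Matrix.smul_apply, smul_eq_mul, mul_comm]
  exact C_mul_mem_firSpan _ (inv_X_pow_mem_firSpan (Finset.mem_range.mp hk))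

theorem resolvent_mem_FIR_of_pow_eq_zero
    (hR : (RatFunc.X : RatFunc ℝ) • R = 1 + const N * R) {T : ℕ} (hN : N ^ T = 0) :
    R ∈ FIR T ι ι := by
  have h := resolvent_eq_sum_add hR T
  have h0 : const (0 : Matrix ι ι ℝ) = 0 := Matrix.map_zero _ (map_zero _)
  rw [hN, h0, Matrix.zero_mul, smul_zero, add_zero] at h
  rw [h]
  exact sum_mem_FIR N T

/-- If `W (zI - N)⁻¹ V` has finite impulse response of horizon `T`, then its Markov parameters
vanish from order `T` on. -/
theorem markov_eq_zero_of_mem_FIR (hR : (RatFunc.X : RatFunc ℝ) • R = 1 + const N * R) {T : ℕ}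
    (W : Matrix μ ι ℝ) (V : Matrix ι κ ℝ) (h : const W * R * const V ∈ FIR T μ κ) (k : ℕ) :
    W * N ^ (T + k) * V = 0 := by
  set M : ℕ → TransferMatrix μ κ := fun j => const (W * N ^ j) * R * const V with hM
  have hlt : ∀ j a b, RatFunc.inftyValuation ℝ (M j a b) < 1 := fun j =>
    inftyValuation_mul_const_lt_one
      (inftyValuation_const_mul_lt_one (inftyValuation_resolvent_lt_one hR) _) V
  have hstep : ∀ j, (RatFunc.X : RatFunc ℝ) • M j = const (W * N ^ j * V) + M (j + 1) := by
    intro j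
    simp only [hM]
    rw [← Matrix.smul_mul, ← Matrix.mul_smul, hR, Matrix.mul_add, Matrix.add_mul, Matrix.mul_one,
      ← const_mul, ← Matrix.mul_assoc (const _) (const N), ← const_mul, Matrix.mul_assoc W (N ^ j) N,
      ← pow_succ]
  -- The remainder of order `T` is a polynomial, being `z ^ T` times an FIR matrix, and it is also
  -- strictly proper.
  have hMT : M T = 0 := by
    have hrem : ((RatFunc.X : RatFunc ℝ) ^ T)⁻¹ • M T ∈ FIR T μ κ := by
      have hdiff : ((RatFunc.X : RatFunc ℝ) ^ T)⁻¹ • M T = const W * R * const V - const W *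
          (∑ k ∈ Finset.range T, ((RatFunc.X : RatFunc ℝ) ^ (k + 1))⁻¹ • const (N ^ k)) *
            const V := by
        conv_rhs => enter [1, 1, 2]; rw [resolvent_eq_sum_add hR T]
        rw [Matrix.mul_add, Matrix.add_mul, add_sub_cancel_left]
        simp only [hM, const_mul, Matrix.mul_smul, Matrix.smul_mul, Matrix.mul_assoc]
      rw [hdiff]
      exact sub_mem_FIR h (mul_const_mem_FIR (const_mul_mem_FIR _ (sum_mem_FIR N T)) _)
    ext a b
    obtain ⟨g, hg⟩ := X_pow_mul_firSpan (mem_FIR_iff.mp hrem a b)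
    rw [Matrix.smul_apply, smul_eq_mul, mul_inv_cancel_left₀ (pow_ne_zero _ RatFunc.X_ne_zero)]
      at hg
    have h0 := eq_zero_of_polynomial_of_inftyValuation_lt_one (hg ▸ hlt T a b)
    rw [hg, h0, map_zero, Matrix.zero_apply]
  -- If `M j = 0`, then the constant `W N ^ j V` equals the strictly proper `-M (j + 1)`.
  have hzero : ∀ j, M j = 0 → W * N ^ j * V = 0 ∧ M (j + 1) = 0 := by
    intro j hj
    have hs := hstep j
    rw [hj, smul_zero] at hs
    have hc : W * N ^ j * V = 0 := by
      ext a b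
      refine eq_zero_of_C_of_inftyValuation_lt_one ?_
      have hab : RatFunc.C ((W * N ^ j * V) a b) = -M (j + 1) a b :=
        eq_neg_of_add_eq_zero_left (congrFun (congrFun hs a) b).symm
      rw [hab, Valuation.map_neg]
      exact hlt _ a b
    refine ⟨hc, ?_⟩
    rw [hc, show const (0 : Matrix μ κ ℝ) = 0 from Matrix.map_zero _ (map_zero _), zero_add] at hs
    exact hs.symm
  have hall : ∀ k, M (T + k) = 0 := by
    intro k
    induction k with
    | zero => exact hMT
    | succ k ih => exact (hzero _ ih).2
  exact (hzero _ (hall k)).1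

end Resolvent

/-! ### The closed-loop realization -/

section ClosedLoopRealization

variable {n m p q T : ℕ} (G : Plant n m p) (K : Controller q m p)

/-- The state matrix of the closed loop, on plant states and controller states. -/
def clMatrix : Matrix (Fin n ⊕ Fin q) (Fin n ⊕ Fin q) ℝ :=
  fromBlocks (G.A + G.B * K.Dk * G.C) (G.B * K.Ck) (K.Bk * G.C) K.Ak

/-- The resolvent of the controller state matrix. -/
noncomputable def ctrlResolvent : TransferMatrix (Fin q) (Fin q) := (zI q - const K.Ak)⁻¹

/-- The resolvent `(zI - N)⁻¹` of the closed-loop state matrix `N = clMatrix G K`, written in terms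
of `Phi_xx` and the resolvent of the controller by block inversion. -/
noncomputable def clResolvent : TransferMatrix (Fin n ⊕ Fin q) (Fin n ⊕ Fin q) :=
  fromBlocks (Phi_xx G K) (Phi_xx G K * const (G.B * K.Ck) * ctrlResolvent K)
    (ctrlResolvent K * const (K.Bk * G.C) * Phi_xx G K)
    (ctrlResolvent K +
      ctrlResolvent K * const (K.Bk * G.C) * Phi_xx G K * const (G.B * K.Ck) * ctrlResolvent K)

theorem transfer_eq : K.transfer = const K.Ck * ctrlResolvent K * const K.Bk + const K.Dk := rfl

theorem X_smul_ctrlResolvent :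
    (RatFunc.X : RatFunc ℝ) • ctrlResolvent K = 1 + const K.Ak * ctrlResolvent K := by
  have h : (zI q - const K.Ak) * ctrlResolvent K = 1 :=
    mul_nonsing_inv _ (isUnit_iff_ne_zero.mpr (det_zI_sub_const_ne_zero K.Ak))
  rw [Matrix.sub_mul, zI, Matrix.smul_mul, Matrix.one_mul, sub_eq_iff_eq_add] at h
  exact h

theorem X_smul_Phi_xx : (RatFunc.X : RatFunc ℝ) • Phi_xx G K =
    1 + (const G.A + const G.B * K.transfer * const G.C) * Phi_xx G K := by
  have h : (zI n - const G.A - const G.B * K.transfer * const G.C) * Phi_xx G K = 1 :=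
    mul_nonsing_inv _ (wellPosed G K)
  rw [sub_sub, Matrix.sub_mul, zI, Matrix.smul_mul, Matrix.one_mul, sub_eq_iff_eq_add] at h
  exact h

theorem X_smul_clResolvent : (RatFunc.X : RatFunc ℝ) • clResolvent G K =
    1 + const (clMatrix G K) * clResolvent G K := by
  have hE := X_smul_ctrlResolvent K
  have hP := X_smul_Phi_xx G K
  have hN : const (clMatrix G K) = fromBlocks (const (G.A + G.B * K.Dk * G.C))
      (const (G.B * K.Ck)) (const (K.Bk * G.C)) (const K.Ak) :=
    fromBlocks_map _ _ _ _ _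
  rw [transfer_eq] at hP
  rw [hN, clResolvent, fromBlocks_smul, fromBlocks_multiply, ← fromBlocks_one, fromBlocks_add]
  simp only [smul_add, ← Matrix.smul_mul, hE, hP]
  simp only [const_mul, const_add, Matrix.add_mul, Matrix.mul_add, Matrix.mul_assoc,
    Matrix.one_mul, zero_add]
  congr 1 <;> abel

/-- `diag(C, Ck)`, reading off the outputs of the plant and of the controller dynamics. -/
def clOutput : Matrix (Fin p ⊕ Fin m) (Fin n ⊕ Fin q) ℝ := fromBlocks G.C 0 0 K.Ck

/-- `diag(B, Bk)`, feeding the inputs of the plant and of the controller dynamics. -/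
def clInput : Matrix (Fin n ⊕ Fin q) (Fin m ⊕ Fin p) ℝ := fromBlocks G.B 0 0 K.Bk

/-- The closed loop arises from the decoupled pair by output injection. -/
theorem clMatrix_eq_add_mul_clOutput : clMatrix G K = fromBlocks G.A 0 0 K.Ak +
    fromBlocks (G.B * K.Dk) G.B K.Bk 0 * clOutput G K := by
  simp [clMatrix, clOutput, fromBlocks_multiply, fromBlocks_add]

/-- The closed loop arises from the decoupled pair by state feedback. -/
theorem clMatrix_eq_add_clInput_mul : clMatrix G K = fromBlocks G.A 0 0 K.Ak +
    clInput G K * fromBlocks (K.Dk * G.C) K.Ck G.C 0 := by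
  simp [clMatrix, clInput, fromBlocks_multiply, fromBlocks_add, Matrix.mul_assoc]

theorem clObservable (hG : Observable G.A G.C) (hK : Observable K.Ak K.Ck) :
    UnobservableTrivial (clMatrix G K) (clOutput G K) := by
  rw [clMatrix_eq_add_mul_clOutput]
  exact (hG.unobservableTrivial.fromBlocks_diagonal hK.unobservableTrivial).add_mul _

theorem clControllable (hG : Controllable G.A G.B) (hK : Controllable K.Ak K.Bk) :
    UnobservableTrivial (clMatrix G K)ᵀ (clInput G K)ᵀ := by
  rw [clMatrix_eq_add_clInput_mul, transpose_add, transpose_mul, fromBlocks_transpose]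
  have h : (clInput G K)ᵀ = fromBlocks G.Bᵀ 0 0 K.Bkᵀ := by
    simp [clInput, fromBlocks_transpose]
  rw [h, transpose_zero, transpose_zero]
  exact (hG.unobservableTrivial.fromBlocks_diagonal hK.unobservableTrivial).add_mul _

/-- Up to constants, the response of the decoupled inputs and outputs through the closed loop is
the response `(δy, δu) → (y, u)`. -/
theorem clOutput_mul_clResolvent_mul_clInput :
    const (clOutput G K) * clResolvent G K * const (clInput G K) =
      fromBlocks (Phi_yu G K) (Phi_yy G K - 1 - Phi_yu G K * const K.Dk)
        (Phi_uu G K - 1 - const K.Dk * Phi_yu G K)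
        (Phi_uy G K - const K.Dk - const K.Dk * (Phi_yy G K - 1) - (Phi_uu G K - 1) * const K.Dk +
          const K.Dk * Phi_yu G K * const K.Dk) := by
  have h0 : ∀ {ι κ : Type}, const (0 : Matrix ι κ ℝ) = 0 := Matrix.map_zero _ (map_zero _)
  have hC : const (clOutput G K) = fromBlocks (const G.C) 0 0 (const K.Ck) := by
    rw [← h0, ← h0]; exact fromBlocks_map _ _ _ _ _
  have hB : const (clInput G K) = fromBlocks (const G.B) 0 0 (const K.Bk) := by
    rw [← h0, ← h0]; exact fromBlocks_map _ _ _ _ _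
  rw [hC, hB, clResolvent, fromBlocks_multiply, fromBlocks_multiply, Phi_yu, Phi_yy, Phi_uu, Phi_uy,
    transfer_eq]
  simp only [Matrix.zero_mul, Matrix.mul_zero, add_zero, zero_add, const_mul, Matrix.add_mul,
    Matrix.mul_add, Matrix.mul_assoc, Matrix.mul_one, add_sub_cancel_right]
  congr 1
  abel

/-! ### Implications between the parameterizations -/

theorem SLP_mem_FIR_of_Phi (h : Phi G K ∈ FIR T _ _) : Phi_SLP G K ∈ FIR T _ _ := by
  simp only [Phi, Phi_SLP, fromBlocks_mem_FIR_iff, fromCols_mem_FIR_iff, fromRows_mem_FIR_iff] at *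
  tauto

theorem Phi_mem_FIR_of_SLP (h : Phi_SLP G K ∈ FIR T _ _) : Phi G K ∈ FIR T _ _ := by
  simp only [Phi, Phi_SLP, fromBlocks_mem_FIR_iff, fromCols_mem_FIR_iff, fromRows_mem_FIR_iff] at *
  obtain ⟨⟨hxx, hxy⟩, hux, huy⟩ := h
  have hyx : Phi_yx G K ∈ FIR T _ _ := const_mul_mem_FIR _ hxx
  refine ⟨⟨hxx, hxy, mul_const_mem_FIR hxx _⟩, ⟨hyx, hux⟩,
    ⟨add_mem_FIR ?_ one_mem_FIR, mul_const_mem_FIR hyx _⟩, huy,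
    add_mem_FIR (mul_const_mem_FIR hux _) one_mem_FIR⟩
  rw [Matrix.mul_assoc, Matrix.mul_assoc, ← Matrix.mul_assoc (Phi_xx G K)]
  exact const_mul_mem_FIR _ hxy

theorem MixedI_mem_FIR_of_Phi (h : Phi G K ∈ FIR T _ _) : Phi_MixedI G K ∈ FIR T _ _ := by
  simp only [Phi, Phi_MixedI, fromBlocks_mem_FIR_iff, fromCols_mem_FIR_iff,
    fromRows_mem_FIR_iff] at *
  tauto

theorem MixedII_mem_FIR_of_Phi (h : Phi G K ∈ FIR T _ _) : Phi_MixedII G K ∈ FIR T _ _ := by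
  simp only [Phi, Phi_MixedII, fromBlocks_mem_FIR_iff, fromCols_mem_FIR_iff,
    fromRows_mem_FIR_iff] at *
  tauto

theorem IOP_mem_FIR_of_MixedI (h : Phi_MixedI G K ∈ FIR T _ _) : Phi_IOP G K ∈ FIR T _ _ := by
  simp only [Phi_MixedI, Phi_IOP, fromBlocks_mem_FIR_iff] at *
  obtain ⟨⟨hyx, hyy⟩, hux, huy⟩ := h
  exact ⟨⟨hyy, mul_const_mem_FIR hyx _⟩, huy, add_mem_FIR (mul_const_mem_FIR hux _) one_mem_FIR⟩

theorem IOP_mem_FIR_of_MixedII (h : Phi_MixedII G K ∈ FIR T _ _) : Phi_IOP G K ∈ FIR T _ _ := by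
  simp only [Phi_MixedII, Phi_IOP, fromBlocks_mem_FIR_iff] at *
  obtain ⟨⟨hxy, hxu⟩, huy, huu⟩ := h
  refine ⟨⟨add_mem_FIR ?_ one_mem_FIR, ?_⟩, huy, huu⟩
  · rw [Matrix.mul_assoc, Matrix.mul_assoc, ← Matrix.mul_assoc (Phi_xx G K)]
    exact const_mul_mem_FIR _ hxy
  · rw [Phi_yu, Matrix.mul_assoc]
    exact const_mul_mem_FIR _ hxu

/-- For a minimal plant and a minimal controller, a deadbeat response `(δy, δu) → (y, u)` forces the
closed-loop state matrix to be nilpotent. -/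
theorem clMatrix_pow_eq_zero (hB : Controllable G.A G.B) (hC : Observable G.A G.C)
    (hBk : Controllable K.Ak K.Bk) (hCk : Observable K.Ak K.Ck) (h : Phi_IOP G K ∈ FIR T _ _) :
    clMatrix G K ^ T = 0 := by
  rw [Phi_IOP, fromBlocks_mem_FIR_iff] at h
  obtain ⟨⟨hyy, hyu⟩, huy, huu⟩ := h
  have hyy' := sub_mem_FIR hyy one_mem_FIR
  have huu' := sub_mem_FIR huu one_mem_FIR
  refine pow_eq_zero_of_markov_eq_zero (clControllable G K hB hBk) (clObservable G K hC hCk)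
    (markov_eq_zero_of_mem_FIR (X_smul_clResolvent G K) _ _ ?_)
  rw [clOutput_mul_clResolvent_mul_clInput, fromBlocks_mem_FIR_iff]
  exact ⟨⟨hyu, sub_mem_FIR hyy' (mul_const_mem_FIR hyu _)⟩,
    sub_mem_FIR huu' (const_mul_mem_FIR _ hyu),
    add_mem_FIR (sub_mem_FIR (sub_mem_FIR (sub_mem_FIR huy (const_mem_FIR _))
      (const_mul_mem_FIR _ hyy')) (mul_const_mem_FIR huu' _))
      (mul_const_mem_FIR (const_mul_mem_FIR _ hyu) _)⟩

theorem SLP_mem_FIR_of_IOP (hB : Controllable G.A G.B) (hC : Observable G.A G.C)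
    (hBk : Controllable K.Ak K.Bk) (hCk : Observable K.Ak K.Ck) (h : Phi_IOP G K ∈ FIR T _ _) :
    Phi_SLP G K ∈ FIR T _ _ := by
  have hR := resolvent_mem_FIR_of_pow_eq_zero (X_smul_clResolvent G K)
    (clMatrix_pow_eq_zero G K hB hC hBk hCk h)
  rw [clResolvent, fromBlocks_mem_FIR_iff] at hR
  obtain ⟨⟨hxx, h₁₂⟩, h₂₁, -⟩ := hR
  rw [Phi_IOP, fromBlocks_mem_FIR_iff] at h
  rw [Phi_SLP, fromBlocks_mem_FIR_iff]
  have hxy : Phi_xy G K = Phi_xx G K * const (G.B * K.Dk) +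
      Phi_xx G K * const (G.B * K.Ck) * ctrlResolvent K * const K.Bk := by
    simp only [Phi_xy, transfer_eq, const_mul, Matrix.mul_add, Matrix.mul_assoc]
    abel
  have hux : Phi_ux G K = const (K.Dk * G.C) * Phi_xx G K +
      const K.Ck * (ctrlResolvent K * const (K.Bk * G.C) * Phi_xx G K) := by
    simp only [Phi_ux, transfer_eq, const_mul, Matrix.add_mul, Matrix.mul_assoc]
    abel
  refine ⟨⟨hxx, ?_⟩, ?_, h.2.1⟩
  · rw [hxy]
    exact add_mem_FIR (mul_const_mem_FIR hxx _) (mul_const_mem_FIR h₁₂ _)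
  · rw [hux]
    exact add_mem_FIR (const_mul_mem_FIR _ hxx) (const_mul_mem_FIR _ h₂₁)

end ClosedLoopRealization

end ClosedLoop

theorem theorem2 (n m p q T : ℕ) (G : ClosedLoop.Plant n m p) (K : ClosedLoop.Controller q m p) :
    ((ClosedLoop.Stabilizable G.A G.B ∧ ClosedLoop.Detectable G.A G.C ∧
        ClosedLoop.Stabilizable K.Ak K.Bk ∧ ClosedLoop.Detectable K.Ak K.Ck) →
      (ClosedLoop.Phi G K ∈ ClosedLoop.FIR T _ _ ↔ ClosedLoop.Phi_SLP G K ∈ ClosedLoop.FIR T _ _) ∧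
      (ClosedLoop.Phi_SLP G K ∈ ClosedLoop.FIR T _ _ →
        ClosedLoop.Phi_MixedI G K ∈ ClosedLoop.FIR T _ _) ∧
      (ClosedLoop.Phi_MixedI G K ∈ ClosedLoop.FIR T _ _ →
        ClosedLoop.Phi_IOP G K ∈ ClosedLoop.FIR T _ _) ∧
      (ClosedLoop.Phi_SLP G K ∈ ClosedLoop.FIR T _ _ →
        ClosedLoop.Phi_MixedII G K ∈ ClosedLoop.FIR T _ _) ∧
      (ClosedLoop.Phi_MixedII G K ∈ ClosedLoop.FIR T _ _ →
        ClosedLoop.Phi_IOP G K ∈ ClosedLoop.FIR T _ _)) ∧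
    ((ClosedLoop.Controllable G.A G.B ∧ ClosedLoop.Observable G.A G.C ∧
        ClosedLoop.Controllable K.Ak K.Bk ∧ ClosedLoop.Observable K.Ak K.Ck) →
      List.TFAE [
        ClosedLoop.Phi G K ∈ ClosedLoop.FIR T _ _,
        ClosedLoop.Phi_SLP G K ∈ ClosedLoop.FIR T _ _,
        ClosedLoop.Phi_MixedI G K ∈ ClosedLoop.FIR T _ _,
        ClosedLoop.Phi_MixedII G K ∈ ClosedLoop.FIR T _ _,
        ClosedLoop.Phi_IOP G K ∈ ClosedLoop.FIR T _ _]) := by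

  open ClosedLoop in
  refine ⟨fun _ => ⟨⟨SLP_mem_FIR_of_Phi G K, Phi_mem_FIR_of_SLP G K⟩,
    fun h => MixedI_mem_FIR_of_Phi G K (Phi_mem_FIR_of_SLP G K h), IOP_mem_FIR_of_MixedI G K,
    fun h => MixedII_mem_FIR_of_Phi G K (Phi_mem_FIR_of_SLP G K h), IOP_mem_FIR_of_MixedII G K⟩,
    fun ⟨hB, hC, hBk, hCk⟩ => ?_⟩
  tfae_have 1 → 3 := ClosedLoop.MixedI_mem_FIR_of_Phi G K
  tfae_have 1 → 4 := ClosedLoop.MixedII_mem_FIR_of_Phi G K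
  tfae_have 3 → 5 := ClosedLoop.IOP_mem_FIR_of_MixedI G K
  tfae_have 4 → 5 := ClosedLoop.IOP_mem_FIR_of_MixedII G K
  tfae_have 5 → 2 := ClosedLoop.SLP_mem_FIR_of_IOP G K hB hC hBk hCk
  tfae_have 2 → 1 := ClosedLoop.Phi_mem_FIR_of_SLP G K
  tfae_finish
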